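/- Let $p$ be a prime such that $2$ is a primitive element of $\mathbb{Z}_p$ (i.e. $2$ has multiplicative order $p-1$ modulo $p$), let $\tau=2^a$ for some integer $a\ge 0$, put $m=p\tau$, and let $k\ge 1$ and $r\ge 9$ be integers. If $k\in\{2,3\}$, assume in addition that $r\le p$. Let $\mathcal{R}=\mathbb{F}_2[x]/(1+x^{m})$ and let $\mathcal{C}\subseteq\mathcal{R}$ be the cyclic code (ideal) generated by $1+x^{\tau}$. To column $j$ of an $m\times(k+r)$ array $(s_{i,j})$ over $\mathbb{F}_2$ attach $s_j(x)=\sum_{i=0}^{m-1}s_{i,j}x^i\in\mathcal{R}$. The code $\mathsf{GEIP}(p,\tau,k,r,2,g(x)=1)$ is the set of all such arrays for which $s_0(x),\dots,s_{k-1}(x)\in\mathcal{C}$ and $$s_{k+j}(x)=\sum_{i=0}^{k-1}x^{ij}s_i(x)\ \text{ in }\mathcal{R},\qquad j=0,1,\dots,r-1 .$$ If $$p-1>\tfrac14\,k\,r\min(k,r)-\tfrac1{12}\min(k,r)^3-\tfrac94\max(k,r)+\tfrac{25}{12}\min(k,r)-4,$$ then this code is MDS: it can recover any set of at most $r$ erased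 columns, that is, two codewords that agree on all columns outside a set of at most $r$ columns are equal. -/

import Mathlib

open Polynomial

namespace GEIP

noncomputable section

/-- The ring `R_m(q) = F[x] / (1 + x ^ m)` over the field `F` with `q` elements. -/
abbrev PolyRing (F : Type*) [Field F] (m : ℕ) : Type _ :=
  AdjoinRoot (1 + X ^ m : F[X])

/-- The class of the indeterminate `x` in `F[x] / (1 + x ^ m)`. -/
def x (F : Type*) [Field F] (m : ℕ) : PolyRing F m :=
  AdjoinRoot.root (1 + X ^ m : F[X])

/-- The cyclic code of length `p * τ` over `F` with generator polynomial `(1 + x ^ τ) * g(x)`,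
as an ideal of `F[x] / (1 + x ^ (p * τ))`. -/
def cyclicCode (F : Type*) [Field F] (p τ : ℕ) (g : F[X]) : Ideal (PolyRing F (p * τ)) :=
  Ideal.span {AdjoinRoot.mk (1 + X ^ (p * τ) : F[X]) ((1 + X ^ τ) * g)}

/-- The polynomial `s_j(x) = s_{0,j} + s_{1,j} x + ⋯ + s_{m-1,j} x ^ (m-1)` attached to column `j`
of an `m × n` array, as an element of `F[x] / (1 + x ^ m)`. -/
def colPoly {F : Type*} [Field F] {m n : ℕ} (s : Matrix (Fin m) (Fin n) F) (j : Fin n) :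
    PolyRing F m :=
  ∑ i : Fin m, algebraMap F (PolyRing F m) (s i j) * x F m ^ (i : ℕ)

/-- The `k × r` encoding matrix whose entry in row `i` and column `j` (counted from `0`) is
`x ^ (i * j)`. -/
def encMatrix (F : Type*) [Field F] (m k r : ℕ) : Matrix (Fin k) (Fin r) (PolyRing F m) :=
  Matrix.of fun i j => x F m ^ ((i : ℕ) * (j : ℕ))

/-- The code `GEIP(p, τ, k, r, q, g(x))` with `q = |F|`: the set of all `pτ × (k + r)` arrays over
`F` whose first `k` column polynomials lie in the cyclic code with generator `(1 + x ^ τ) g(x)`,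
and whose last `r` column polynomials are the product of the row vector of the first `k` column
polynomials with the encoding matrix. -/
def code (p τ k r : ℕ) (F : Type*) [Field F] (g : F[X]) :
    Set (Matrix (Fin (p * τ)) (Fin (k + r)) F) :=
  {s | (∀ j : Fin k, colPoly s (Fin.castAdd r j) ∈ cyclicCode F p τ g) ∧
    (fun j : Fin r => colPoly s (Fin.natAdd k j)) =
      Matrix.vecMul (fun j : Fin k => colPoly s (Fin.castAdd r j)) (encMatrix F (p * τ) k r)}

/-- An array code with `k + r` columns is MDS if it can recover any set `E` of at most `r` erased
columns: a codeword is determined by its columns outside `E`. -/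
def IsMDS {F : Type*} {m : ℕ} (k r : ℕ) (𝒞 : Set (Matrix (Fin m) (Fin (k + r)) F)) : Prop :=
  ∀ E : Finset (Fin (k + r)), E.card ≤ r →
    ∀ s ∈ 𝒞, ∀ t ∈ 𝒞, (∀ j ∉ E, ∀ i, s i j = t i j) → s = t

end

end GEIP

/-! By linearity, take a codeword vanishing off the erased columns. If `s` information columns are
erased, at least `s` parity columns survive, and their equations form a square system whose
determinant `D` has entries `X ^ (f a * g b)`. Since `1 + X^(pτ) = (1 + X^τ) Φ_p^τ` with `Φ_p`
irreducible over `𝔽₂`, multiplication by `D` is injective on the cyclic code once `Φ_p ∤ D`.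

The Vandermonde determinant `V` in the `X ^ g b` divides `D`. If the `g b` are below `p`, `V` is
coprime to `Φ_p`, so `Φ_p ∣ D` would give `Φ_p V ∣ D`. Comparing degree minus trailing degree, which
the rearrangement inequality computes, bounds `p - 1` by at most `s (n - s) (N - 1) / 2`, where `n =
min k r` and `N = max k r`. For `3 ≤ s < n` this contradicts the hypothesis; `s ≤ 1`, `s = 2` and `s
= n` are settled directly. -/

/-- Induction on the size: subtracting row 0 makes each other row divisible by `v b - v 0`, and the
quotients are again polynomial values. -/
theorem Matrix.det_vandermonde_dvd_det_eval {R : Type*} [CommRing R] :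
    ∀ {s : ℕ} (f : Fin s → R[X]) (v : Fin s → R),
      (Matrix.vandermonde v).det ∣ (Matrix.of fun b a => (f a).eval (v b)).det
  | 0, _, _ => by simp
  | s + 1, f, v => by
    have hg : ∀ a, ∃ g : R[X], f a - C ((f a).eval (v 0)) = (X - C (v 0)) * g := fun a =>
      X_sub_C_dvd_sub_C_eval
    choose g hg using hg
    have hg' (a : Fin (s + 1)) (y : R) :
        (f a).eval y = (y - v 0) * (g a).eval y + (f a).eval (v 0) := by
      have h := congrArg (eval y) (hg a)
      simp only [eval_sub, eval_C, eval_mul, eval_X] at h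
      rw [← h]; ring
    have hdet : (Matrix.of fun b a => (f a).eval (v b)).det =
        (Matrix.of (Fin.cons (fun a => (f a).eval (v 0))
          fun (b : Fin s) a => (v b.succ - v 0) * (g a).eval (v b.succ)) :
          Matrix (Fin (s + 1)) (Fin (s + 1)) R).det := by
      refine Matrix.det_eq_of_forall_row_eq_smul_add_const (Fin.cons 0 fun _ => 1) 0
        (Fin.cons_zero _ _) fun b a => ?_
      refine Fin.cases ?_ (fun b => ?_) b
      · simp
      · simpa using hg' a (v b.succ)
    rw [hdet, Matrix.det_vandermonde, Fin.prod_univ_succ, Fin.prod_Ioi_zero,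
      Matrix.det_succ_row_zero]
    refine Finset.dvd_sum fun a _ => ?_
    have hsub : (Matrix.of (Fin.cons (fun a => (f a).eval (v 0))
          fun (b : Fin s) a => (v b.succ - v 0) * (g a).eval (v b.succ)) :
          Matrix (Fin (s + 1)) (Fin (s + 1)) R).submatrix Fin.succ a.succAbove =
        Matrix.of fun (b c : Fin s) => (v b.succ - v 0) *
          (Matrix.of fun b c => (g (a.succAbove c)).eval (v b.succ) : Matrix _ _ R) b c := by
      ext b c
      simp
    rw [hsub, Matrix.det_mul_column]
    refine Dvd.dvd.mul_left (mul_dvd_mul_left _ ?_) _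
    have ih := Matrix.det_vandermonde_dvd_det_eval (fun c => g (a.succAbove c))
      (fun b : Fin s => v b.succ)
    rw [Matrix.det_vandermonde] at ih
    simpa only [Fin.prod_Ioi_succ] using ih

namespace GEIP

/-- The generalized Vandermonde determinant with entries `X ^ (f a * g b)`. -/
noncomputable def monomialDet (F : Type*) [CommRing F] {s : ℕ} (f g : Fin s → ℕ) : F[X] :=
  (Matrix.of fun a b => (X : F[X]) ^ (f a * g b)).det

/-! ### Extreme exponents of the generalized Vandermonde determinant -/

theorem coeff_monomialDet (F : Type*) [CommRing F] {s : ℕ} (f g : Fin s → ℕ) (e : ℕ) :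
    (monomialDet F f g).coeff e =
      ∑ σ : Equiv.Perm (Fin s), if e = ∑ a, f a * g (σ a) then ((σ.sign : ℤ) : F) else 0 := by
  rw [monomialDet, ← Matrix.det_transpose, Matrix.det_apply', finsetSum_coeff]
  refine Finset.sum_congr rfl fun σ _ => ?_
  simp only [Matrix.transpose_apply, Matrix.of_apply, Finset.prod_pow_eq_pow_sum]
  rw [← map_intCast (C : F →+* F[X]), coeff_C_mul, coeff_X_pow]
  split_ifs <;> simp

theorem monomialDet_comm (F : Type*) [CommRing F] {s : ℕ} (f g : Fin s → ℕ) :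
    monomialDet F f g = monomialDet F g f := by
  rw [monomialDet, ← Matrix.det_transpose, monomialDet]
  congr 1
  ext1 a b
  simp [mul_comm]

theorem sum_mul_perm_lt {s : ℕ} {f g : Fin s → ℕ} (hf : StrictMono f) (hg : StrictMono g)
    {σ : Equiv.Perm (Fin s)} (hσ : σ ≠ 1) : ∑ a, f a * g (σ a) < ∑ a, f a * g a := by
  rw [(hf.monotone.monovary hg.monotone).sum_mul_comp_perm_lt_sum_mul_iff]
  intro h
  apply hσ
  have hmono : StrictMono σ := by
    refine Monotone.strictMono_of_injective (fun a b hab => ?_) σ.injective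
    by_contra! hlt
    exact absurd (hf.le_iff_le.1 (h (hg hlt))) (by
      intro hba
      exact hlt.ne (congrArg σ (le_antisymm hba hab)))
  ext a
  have := Subsingleton.elim (hmono.orderIsoOfSurjective _ σ.surjective) (OrderIso.refl _)
  exact congrArg Fin.val (DFunLike.congr_fun this a)

theorem sum_mul_rev_lt {s : ℕ} {f g : Fin s → ℕ} (hf : StrictMono f) (hg : StrictMono g)
    {σ : Equiv.Perm (Fin s)} (hσ : σ ≠ Fin.revPerm) :
    ∑ a, f a * g (Fin.rev a) < ∑ a, f a * g (σ a) := by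
  have hanti : Antivary f (g ∘ Fin.revPerm) := by
    refine hf.monotone.antivary (hg.monotone.comp_antitone fun a b hab => ?_)
    simpa using hab
  have key := (hanti.sum_mul_lt_sum_mul_comp_perm_iff (σ := Fin.revPerm * σ)).2
  simp only [smul_eq_mul, Function.comp, Equiv.Perm.mul_apply, Fin.revPerm_apply,
    Fin.rev_rev] at key
  refine key fun h => hσ ?_
  have hmono : StrictMono (fun a => Fin.rev (σ a)) := by
    refine Monotone.strictMono_of_injective (fun a b hab => ?_)
      (Fin.rev_injective.comp σ.injective)
    by_contra! hlt
    have hlt' : σ a < σ b := by simpa using hlt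
    have h' : g (Fin.rev (Fin.rev (σ a))) < g (Fin.rev (Fin.rev (σ b))) := by
      simpa only [Fin.rev_rev] using hg hlt'
    have hba := hf.le_iff_le.1 (h h')
    exact hlt'.ne (congrArg σ (le_antisymm hab hba))
  ext a
  have := Subsingleton.elim
    (hmono.orderIsoOfSurjective _ (Fin.rev_surjective.comp σ.surjective)) (OrderIso.refl _)
  have ha : Fin.rev (σ a) = a := DFunLike.congr_fun this a
  rw [← Fin.rev_rev (σ a), ha]
  rfl

section Degree

variable (F : Type*) [CommRing F] [Nontrivial F] {s : ℕ} {f g : Fin s → ℕ}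

theorem intCast_sign_ne_zero (σ : Equiv.Perm (Fin s)) : ((σ.sign : ℤ) : F) ≠ 0 := by
  rcases Int.units_eq_one_or σ.sign with h | h <;> simp [h]

/-- The identity is the unique maximizer in the Leibniz sum, so nothing cancels, even modulo 2;
reversal plays this role for the minimum. -/
theorem coeff_monomialDet_max (hf : StrictMono f) (hg : StrictMono g) :
    (monomialDet F f g).coeff (∑ a, f a * g a) ≠ 0 := by
  rw [coeff_monomialDet, Finset.sum_eq_single 1 (fun σ _ hσ =>
    if_neg (sum_mul_perm_lt hf hg hσ).ne') (by simp)]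
  simp

theorem coeff_monomialDet_min (hf : StrictMono f) (hg : StrictMono g) :
    (monomialDet F f g).coeff (∑ a, f a * g (Fin.rev a)) ≠ 0 := by
  rw [coeff_monomialDet, Finset.sum_eq_single Fin.revPerm (fun σ _ hσ =>
    if_neg (sum_mul_rev_lt hf hg hσ).ne) (by simp)]
  simpa using intCast_sign_ne_zero F _

theorem monomialDet_ne_zero (hf : StrictMono f) (hg : StrictMono g) :
    monomialDet F f g ≠ 0 := fun h => coeff_monomialDet_max F hf hg (by simp [h])

theorem natDegree_monomialDet (hf : StrictMono f) (hg : StrictMono g) :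
    (monomialDet F f g).natDegree = ∑ a, f a * g a := by
  refine le_antisymm (natDegree_le_iff_coeff_eq_zero.2 fun e he => ?_)
    (le_natDegree_of_ne_zero (coeff_monomialDet_max F hf hg))
  rw [coeff_monomialDet]
  refine Finset.sum_eq_zero fun σ _ => if_neg ?_
  by_cases hσ : σ = 1
  · subst hσ; exact he.ne'
  · exact ((sum_mul_perm_lt hf hg hσ).trans he).ne'

theorem natTrailingDegree_monomialDet (hf : StrictMono f) (hg : StrictMono g) :
    (monomialDet F f g).natTrailingDegree = ∑ a, f a * g (Fin.rev a) := by
  refine le_antisymm (natTrailingDegree_le_of_ne_zero (coeff_monomialDet_min F hf hg))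
    (le_natTrailingDegree (monomialDet_ne_zero F hf hg) fun e he => ?_)
  rw [coeff_monomialDet]
  refine Finset.sum_eq_zero fun σ _ => if_neg ?_
  by_cases hσ : σ = Fin.revPerm
  · subst hσ; exact he.ne
  · exact (he.trans (sum_mul_rev_lt hf hg hσ)).ne

end Degree

theorem monomialDet_val (F : Type*) [CommRing F] {s : ℕ} (g : Fin s → ℕ) :
    monomialDet F (fun a => (a : ℕ)) g =
      (Matrix.vandermonde fun b => (X : F[X]) ^ g b).det := by
  rw [monomialDet_comm, monomialDet]
  congr 1
  ext1 a b
  simp [pow_mul]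

theorem monomialDet_val_dvd (F : Type*) [CommRing F] {s : ℕ} (f g : Fin s → ℕ) :
    monomialDet F (fun a => (a : ℕ)) g ∣ monomialDet F f g := by
  rw [monomialDet_val, monomialDet_comm]
  convert Matrix.det_vandermonde_dvd_det_eval (fun a => (X : F[X][X]) ^ f a)
    (fun b => (X : F[X]) ^ g b) using 1
  rw [monomialDet]
  congr 1
  ext1 a b
  simp [pow_mul]

/-! ### Divisibility by the cyclotomic polynomial over `𝔽₂` -/

theorem prime_two_primitive_ne_two {p : ℕ} (h2 : orderOf (2 : ZMod p) = p - 1) : p ≠ 2 := by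
  rintro rfl
  have h := pow_orderOf_eq_one (2 : ZMod 2)
  rw [h2] at h
  revert h
  decide

/-- The irreducible factors of `Φ_p` over `𝔽₂` have degree the order of 2 modulo `p`, here `p - 1`.
-/
theorem irreducible_cyclotomic_two {p : ℕ} (hp : p.Prime)
    (h2 : orderOf (2 : ZMod p) = p - 1) : Irreducible (cyclotomic p (ZMod 2)) := by
  have hp2 : ¬ 2 ∣ p := fun h =>
    prime_two_primitive_ne_two h2 ((Nat.prime_dvd_prime_iff_eq Nat.prime_two hp).1 h).symm
  refine ZMod.irreducible_of_dvd_cyclotomic_of_natDegree hp2 dvd_rfl ?_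
  rw [natDegree_cyclotomic, Nat.totient_prime hp, ← h2, ← orderOf_units, ZMod.coe_unitOfCoprime]
  rfl

theorem modEq_of_cyclotomic_dvd {p : ℕ} (hp : p.Prime) (h2 : orderOf (2 : ZMod p) = p - 1)
    {a b : ℕ} (h : cyclotomic p (ZMod 2) ∣ X ^ a - X ^ b) : a ≡ b [MOD p] := by
  have hirr := irreducible_cyclotomic_two hp h2
  have : Fact (Irreducible (cyclotomic p (ZMod 2))) := ⟨hirr⟩
  let K := AdjoinRoot (cyclotomic p (ZMod 2))
  have hp0 : (p : ZMod 2) ≠ 0 := by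
    rw [Ne, ZMod.natCast_eq_zero_iff, Nat.prime_dvd_prime_iff_eq Nat.prime_two hp]
    exact (prime_two_primitive_ne_two h2).symm
  have : NeZero (p : K) := ⟨by
    rw [← map_natCast (algebraMap (ZMod 2) K)]
    exact (_root_.map_ne_zero _).2 hp0⟩
  have hζ : IsPrimitiveRoot (AdjoinRoot.root (cyclotomic p (ZMod 2)) : K) p := by
    rw [← isRoot_cyclotomic_iff]
    have := AdjoinRoot.isRoot_root (cyclotomic p (ZMod 2))
    rwa [map_cyclotomic] at this
  have hroot := AdjoinRoot.mk_eq_zero.2 h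
  rw [map_sub, map_pow, map_pow, AdjoinRoot.mk_X, sub_eq_zero] at hroot
  rwa [(isOfFinOrder_iff_pow_eq_one.2 ⟨p, hp.pos, hζ.pow_eq_one⟩).pow_eq_pow_iff_modEq,
    ← hζ.eq_orderOf] at hroot

/-- A factor `X ^ g j - X ^ g i` divisible by `Φ_p` forces `g i ≡ g j` modulo `p`. For `s ≤ 1` the
product is empty and no bound on `g` is needed. -/
theorem not_cyclotomic_dvd_vandermonde {p : ℕ} (hp : p.Prime)
    (h2 : orderOf (2 : ZMod p) = p - 1) {s : ℕ} {g : Fin s → ℕ} (hg : StrictMono g)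
    (hgp : 1 < s → ∀ b, g b < p) :
    ¬ cyclotomic p (ZMod 2) ∣ monomialDet (ZMod 2) (fun a => (a : ℕ)) g := by
  have hprime := (irreducible_cyclotomic_two hp h2).prime
  rw [monomialDet_val, Matrix.det_vandermonde, hprime.dvd_finsetProd_iff]
  rintro ⟨i, -, h⟩
  rw [hprime.dvd_finsetProd_iff] at h
  obtain ⟨j, hj, h⟩ := h
  have hij : i < j := Finset.mem_Ioi.1 hj
  have hs : 1 < s := by have := i.2; have := j.2; have : (i : ℕ) < j := hij; omega
  have := (modEq_of_cyclotomic_dvd hp h2 h).eq_of_lt_of_lt (hgp hs j) (hgp hs i)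
  exact (hg hij).ne' this

theorem degree_bound_of_cyclotomic_dvd {p : ℕ} (hp : p.Prime)
    (h2 : orderOf (2 : ZMod p) = p - 1) {s : ℕ} {f g : Fin s → ℕ} (hf : StrictMono f)
    (hg : StrictMono g) (hgp : 1 < s → ∀ b, g b < p)
    (h : cyclotomic p (ZMod 2) ∣ monomialDet (ZMod 2) f g) :
    p - 1 + ∑ a : Fin s, (a : ℕ) * g a + ∑ a, f a * g (Fin.rev a) ≤
      ∑ a, f a * g a + ∑ a : Fin s, (a : ℕ) * g (Fin.rev a) := by
  have hirr := irreducible_cyclotomic_two hp h2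
  have hval : StrictMono fun a : Fin s => (a : ℕ) := fun _ _ h => h
  have hcop : IsCoprime (cyclotomic p (ZMod 2))
      (monomialDet (ZMod 2) (fun a => (a : ℕ)) g) :=
    hirr.coprime_iff_not_dvd.2 (not_cyclotomic_dvd_vandermonde hp h2 hg hgp)
  obtain ⟨Q, hQ⟩ := hcop.mul_dvd h (monomialDet_val_dvd (ZMod 2) f g)
  have hV := monomialDet_ne_zero (ZMod 2) hval hg
  have hD := monomialDet_ne_zero (ZMod 2) hf hg
  have hQ0 : Q ≠ 0 := by rintro rfl; exact hD (by simpa using hQ)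
  have hdeg := congrArg natDegree hQ
  have htr := congrArg natTrailingDegree hQ
  rw [natDegree_mul (mul_ne_zero hirr.ne_zero hV) hQ0, natDegree_mul hirr.ne_zero hV,
    natDegree_monomialDet _ hf hg, natDegree_monomialDet _ hval hg, natDegree_cyclotomic,
    Nat.totient_prime hp] at hdeg
  have hc : (cyclotomic p (ZMod 2)).natTrailingDegree = 0 := by
    rw [natTrailingDegree_eq_zero]
    right
    rw [cyclotomic_coeff_zero _ hp.one_lt]
    exact one_ne_zero
  rw [natTrailingDegree_mul (mul_ne_zero hirr.ne_zero hV) hQ0,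
    natTrailingDegree_mul hirr.ne_zero hV, natTrailingDegree_monomialDet _ hf hg,
    natTrailingDegree_monomialDet _ hval hg, hc] at htr
  -- The cofactor has nonnegative span; `Φ_p` has span `p - 1`.
  have := natTrailingDegree_le_natDegree Q
  omega

/-! ### Numerical estimates -/

theorem two_mul_sum_sub_rev {s : ℕ} (u v : Fin s → ℤ) :
    2 * (∑ a, u a * v a - ∑ a, u a * v (Fin.rev a)) =
      ∑ a, (u a - u (Fin.rev a)) * (v a - v (Fin.rev a)) := by
  have h1 : ∑ a, u (Fin.rev a) * v (Fin.rev a) = ∑ a, u a * v a :=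
    Equiv.sum_comp Fin.revPerm fun a => u a * v a
  have h2 : ∑ a, u (Fin.rev a) * v a = ∑ a, u a * v (Fin.rev a) := by
    rw [← Equiv.sum_comp Fin.revPerm]
    simp
  simp only [sub_mul, mul_sub, Finset.sum_sub_distrib, h1, h2]
  ring

theorem strictMono_sub_val_monotone {s : ℕ} {f : Fin s → ℕ} (hf : StrictMono f) :
    Monotone fun a => (f a : ℤ) - (a : ℕ) := by
  cases s with
  | zero => exact fun a => a.elim0
  | succ s =>
    refine Fin.monotone_iff_le_succ.2 fun a => ?_
    have := hf (Fin.castSucc_lt_succ (i := a))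
    simp only [Fin.val_castSucc, Fin.val_succ]
    push_cast
    omega

theorem sub_val_mem_Icc {s n : ℕ} {f : Fin s → ℕ} (hf : StrictMono f) (hfn : ∀ a, f a < n)
    (a : Fin s) : 0 ≤ (f a : ℤ) - (a : ℕ) ∧ (f a : ℤ) - (a : ℕ) ≤ n - s := by
  cases s with
  | zero => exact a.elim0
  | succ s =>
    have h0 := strictMono_sub_val_monotone hf (Fin.zero_le a)
    have h1 := strictMono_sub_val_monotone hf (Fin.le_last a)
    have := hfn (Fin.last s)
    simp only [Fin.val_zero, Fin.val_last] at h0 h1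
    push_cast
    omega

/-- Subtracting the span of `V` replaces `f a` by `f a - a`, which lies in `[0, n - s]`.
Symmetrizing under reversal then gains the factor 2. -/
theorem two_mul_pred_le_of_cyclotomic_dvd {p : ℕ} (hp : p.Prime)
    (h2 : orderOf (2 : ZMod p) = p - 1) {s n N : ℕ} {f g : Fin s → ℕ} (hf : StrictMono f)
    (hg : StrictMono g) (hfn : ∀ a, f a < n) (hgN : ∀ a, g a < N)
    (hgp : 1 < s → ∀ b, g b < p)
    (h : cyclotomic p (ZMod 2) ∣ monomialDet (ZMod 2) f g) :
    2 * ((p : ℤ) - 1) ≤ s * ((n - s) * (N - 1)) := by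
  have hbd := degree_bound_of_cyclotomic_dvd hp h2 hf hg hgp h
  have hbd' : (p : ℤ) - 1 ≤ ∑ a, ((f a : ℤ) - (a : ℕ)) * (g a : ℤ) -
      ∑ a, ((f a : ℤ) - (a : ℕ)) * (g (Fin.rev a) : ℤ) := by
    have := hp.one_lt
    zify [this.le] at hbd
    simp only [sub_mul, Finset.sum_sub_distrib]
    linarith
  have hterm : ∑ a : Fin s, (((f a : ℤ) - (a : ℕ)) - ((f (Fin.rev a) : ℤ) - (Fin.rev a : ℕ))) *
      ((g a : ℤ) - g (Fin.rev a)) ≤ ∑ _a : Fin s, ((n : ℤ) - s) * (N - 1) := by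
    refine Finset.sum_le_sum fun a _ => ?_
    obtain ⟨ha0, ha1⟩ := sub_val_mem_Icc hf hfn a
    obtain ⟨hb0, hb1⟩ := sub_val_mem_Icc hf hfn (Fin.rev a)
    have hga := hgN a
    have hgb := hgN (Fin.rev a)
    refine (le_abs_self _).trans ?_
    rw [abs_mul]
    refine mul_le_mul (abs_le.2 ⟨by linarith, by linarith⟩) (abs_le.2 ⟨by omega, by omega⟩)
      (abs_nonneg _) (by linarith)
  have := two_mul_sum_sub_rev (fun a : Fin s => (f a : ℤ) - (a : ℕ)) (fun a => (g a : ℤ))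
  simp only [Finset.sum_const, Finset.card_univ, Fintype.card_fin, nsmul_eq_mul] at hterm
  linarith

/-- The lower bound on `p - 1` for a code with `min k r = n` and `max k r = N`. -/
noncomputable def degreeBound (n N : ℝ) : ℝ :=
  1 / 4 * n * N * n - 1 / 12 * n ^ 3 - 9 / 4 * N + 25 / 12 * n - 4

theorem le_of_degreeBound_lt {p n N : ℕ} (hnN : n ≤ N) (hN : 9 ≤ N) (hn : 4 ≤ n)
    (hb : degreeBound n N < (p : ℝ) - 1) : N ≤ p := by
  have hnN' : (n : ℝ) ≤ N := by exact_mod_cast hnN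
  have hN' : (9 : ℝ) ≤ N := by exact_mod_cast hN
  unfold degreeBound at hb
  suffices (N : ℝ) ≤ p by exact_mod_cast this
  rcases hn.eq_or_lt with rfl | hn
  · push_cast at hb; linarith
  · have hn' : (5 : ℝ) ≤ n := by exact_mod_cast hn
    -- `n ^ 2 / 4 - 13 / 4` is the coefficient of `N` in `degreeBound n N - N`; being positive, it
    -- lets `N` be lowered to `n`.
    have h1 : 0 ≤ ((n : ℝ) ^ 2 / 4 - 13 / 4) * (N - n) :=
      mul_nonneg (by nlinarith) (by linarith)
    have h3 : 0 ≤ (n : ℝ) * (n - 5) * (n + 5) := by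
      apply mul_nonneg (mul_nonneg _ _) <;> linarith
    nlinarith

theorem mul_le_degreeBound {n N s : ℕ} (hnN : n ≤ N) (hs : 3 ≤ s) (hsn : s < n) (hN : 9 ≤ N) :
    (s : ℝ) * ((n - s) * (N - 1)) ≤ 2 * degreeBound n N := by
  have hnN' : (n : ℝ) ≤ N := by exact_mod_cast hnN
  have hN' : (9 : ℝ) ≤ N := by exact_mod_cast hN
  unfold degreeBound
  -- With `s (n - s) ≤ n ^ 2 / 4`, the coefficient of `N` left over is `n ^ 2 / 4 - 9 / 2`, negative
  -- at `n = 4`.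
  rcases Nat.lt_or_ge n 5 with hn | hn
  · obtain rfl : n = 4 := by omega
    obtain rfl : s = 3 := by omega
    norm_num
    linarith
  · have hn' : (5 : ℝ) ≤ n := by exact_mod_cast hn
    have h0 : (s : ℝ) * (n - s) ≤ n ^ 2 / 4 := by nlinarith [sq_nonneg ((n : ℝ) - 2 * s)]
    have h1 : (s : ℝ) * (n - s) * (N - 1) ≤ n ^ 2 / 4 * (N - 1) :=
      mul_le_mul_of_nonneg_right h0 (by linarith)
    have h2 : 0 ≤ ((n : ℝ) ^ 2 / 4 - 9 / 2) * (N - n) :=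
      mul_nonneg (by nlinarith) (by linarith)
    have h3 : 0 ≤ (n : ℝ) * (n - 5) * (n + 5) := by
      apply mul_nonneg (mul_nonneg _ _) <;> linarith
    nlinarith

/-- The two exponents differ by `(f 1 - f 0) * (g 1 - g 0)`, a product of positive integers below
`p`. -/
theorem not_cyclotomic_dvd_monomialDet_two {p : ℕ} (hp : p.Prime)
    (h2 : orderOf (2 : ZMod p) = p - 1) {f g : Fin 2 → ℕ} (hf : StrictMono f)
    (hg : StrictMono g) (hfp : ∀ b, f b < p) (hgp : ∀ b, g b < p) :
    ¬ cyclotomic p (ZMod 2) ∣ monomialDet (ZMod 2) f g := by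
  intro h
  rw [monomialDet, Matrix.det_fin_two] at h
  simp only [Matrix.of_apply, ← pow_add] at h
  have hmod := (modEq_of_cyclotomic_dvd hp h2 h).symm.dvd
  have hf1 := hf (Fin.zero_lt_one)
  have hg1 := hg (Fin.zero_lt_one)
  have hf2 := hfp 1
  have hg2 := hgp 1
  have hfac : ((f 0 * g 0 + f 1 * g 1 : ℕ) : ℤ) - (f 0 * g 1 + f 1 * g 0 : ℕ) =
      ((f 1 : ℤ) - f 0) * (g 1 - g 0) := by push_cast; ring
  rw [hfac] at hmod
  rcases (Nat.prime_iff_prime_int.1 hp).dvd_or_dvd hmod with hd | hd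
  · have := Int.le_of_dvd (by omega) hd; omega
  · have := Int.le_of_dvd (by omega) hd; omega

theorem not_cyclotomic_dvd_monomialDet {p : ℕ} (hp : p.Prime)
    (h2 : orderOf (2 : ZMod p) = p - 1) {s n N : ℕ} {f g : Fin s → ℕ} (hf : StrictMono f)
    (hg : StrictMono g) (hfn : ∀ a, f a < n) (hgN : ∀ a, g a < N) (hnN : n ≤ N) (hN : 9 ≤ N)
    (hnp : n = 2 ∨ n = 3 → N ≤ p) (hb : degreeBound n N < (p : ℝ) - 1) :
    ¬ cyclotomic p (ZMod 2) ∣ monomialDet (ZMod 2) f g := by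
  intro h
  have hsn : s ≤ n := by
    simpa using Fintype.card_le_of_injective (fun a => (⟨f a, hfn a⟩ : Fin n))
      fun a b hab => hf.injective (congrArg Fin.val hab)
  have hNp : 1 < s → N ≤ p := fun hs => by
    rcases Nat.lt_or_ge n 4 with hn | hn
    · exact hnp (by omega)
    · exact le_of_degreeBound_lt hnN hN hn hb
  have hgp : 1 < s → ∀ b, g b < p := fun hs b => (hgN b).trans_le (hNp hs)
  have hp1 := hp.one_lt
  rcases Nat.lt_or_ge 1 s with hs | hs
  · rcases Nat.eq_or_lt_of_le (show 2 ≤ s from hs) with rfl | hs3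
    · exact not_cyclotomic_dvd_monomialDet_two hp h2 hf hg
        (fun b => (hfn b).trans_le (hnN.trans (hNp hs))) (hgp hs) h
    · have key := two_mul_pred_le_of_cyclotomic_dvd hp h2 hf hg hfn hgN hgp h
      -- For `s = n` the upper bound is 0.
      rcases hsn.eq_or_lt with rfl | hsn
      · simp at key
        omega
      · have := mul_le_degreeBound hnN hs3 hsn hN
        have key' : 2 * ((p : ℝ) - 1) ≤ s * ((n - s) * (N - 1)) := by exact_mod_cast key
        linarith
  -- For `s ≤ 1` reversal is trivial, so the bound reads `p - 1 ≤ 0`.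
  · have key := degree_bound_of_cyclotomic_dvd hp h2 hf hg hgp h
    have hrev (a : Fin s) : Fin.rev a = a := by
      ext
      rw [Fin.val_rev]
      omega
    simp only [hrev] at key
    omega

/-! ### From nonvanishing minors to erasure recovery -/

theorem one_add_X_pow_eq {p τ : ℕ} (hp : p.Prime) (hτ : ∃ a : ℕ, τ = 2 ^ a) :
    (1 + X ^ (p * τ) : (ZMod 2)[X]) = (1 + X ^ τ) * cyclotomic p (ZMod 2) ^ τ := by
  obtain ⟨a, rfl⟩ := hτ
  have : Fact p.Prime := ⟨hp⟩
  have h := cyclotomic_prime_mul_X_sub_one (ZMod 2) p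
  rw [CharTwo.sub_eq_add, CharTwo.sub_eq_add] at h
  have h1 : ∀ y : (ZMod 2)[X], 1 + y ^ 2 ^ a = (1 + y) ^ 2 ^ a := fun y => by
    rw [add_pow_char_pow, one_pow]
  rw [pow_mul, h1, h1, ← mul_pow, add_comm 1 (X ^ p), ← h, add_comm X 1, mul_comm]

/-- Cancelling `1 + X ^ τ` leaves a congruence modulo `Φ_p ^ τ`, where `D` is a unit. -/
theorem eq_zero_of_mem_cyclicCode {p τ : ℕ} (hp : p.Prime) (h2 : orderOf (2 : ZMod p) = p - 1)
    (hτ : ∃ a : ℕ, τ = 2 ^ a) {D : (ZMod 2)[X]} (hD : ¬ cyclotomic p (ZMod 2) ∣ D)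
    {z : PolyRing (ZMod 2) (p * τ)} (hz : z ∈ cyclicCode (ZMod 2) p τ 1)
    (h : AdjoinRoot.mk (1 + X ^ (p * τ)) D * z = 0) : z = 0 := by
  obtain ⟨c, rfl⟩ := Ideal.mem_span_singleton.1 hz
  obtain ⟨c, rfl⟩ := AdjoinRoot.mk_surjective c
  have hτ0 : (1 + X ^ τ : (ZMod 2)[X]) ≠ 0 := by
    obtain ⟨a, rfl⟩ := hτ
    rw [add_comm, ← C_1]
    exact X_pow_add_C_ne_zero (by positivity) 1
  rw [mul_one] at h ⊢
  rw [← map_mul, ← map_mul, AdjoinRoot.mk_eq_zero, one_add_X_pow_eq hp hτ, mul_left_comm,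
    mul_dvd_mul_iff_left hτ0] at h
  rw [← map_mul, AdjoinRoot.mk_eq_zero, one_add_X_pow_eq hp hτ, mul_dvd_mul_iff_left hτ0]
  exact (((irreducible_cyclotomic_two hp h2).coprime_iff_not_dvd.2 hD).pow_left).dvd_of_dvd_mul_left
    h

theorem colPoly_sub {F : Type*} [Field F] {m n : ℕ} (s t : Matrix (Fin m) (Fin n) F)
    (j : Fin n) : colPoly (s - t) j = colPoly s j - colPoly t j := by
  simp [colPoly, sub_mul]

theorem colPoly_eq_mk {F : Type*} [Field F] {m n : ℕ} (s : Matrix (Fin m) (Fin n) F)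
    (j : Fin n) :
    colPoly s j = AdjoinRoot.mk (1 + X ^ m) (∑ i : Fin m, C (s i j) * X ^ (i : ℕ)) := by
  simp only [colPoly, x, map_sum, map_mul, map_pow, AdjoinRoot.mk_X, AdjoinRoot.mk_C]
  rfl

theorem eq_zero_of_colPoly_eq_zero {F : Type*} [Field F] {m n : ℕ}
    {s : Matrix (Fin m) (Fin n) F} {j : Fin n} (h : colPoly s j = 0) (i : Fin m) :
    s i j = 0 := by
  rw [colPoly_eq_mk, AdjoinRoot.mk_eq_zero] at h
  have hm : 0 < m := i.pos
  have hzero : (∑ i : Fin m, C (s i j) * X ^ (i : ℕ) : F[X]) = 0 := by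
    refine eq_zero_of_dvd_of_degree_lt h ?_
    rw [add_comm, ← C_1, degree_X_pow_add_C hm]
    refine (degree_sum_le _ _).trans_lt ((Finset.sup_lt_iff (by simp)).2 fun a _ => ?_)
    exact (degree_C_mul_X_pow_le _ _).trans_lt (by exact_mod_cast a.2)
  have := congrArg (coeff · (i : ℕ)) hzero
  simpa [finsetSum_coeff, coeff_C_mul, coeff_X_pow, Fin.val_inj] using this

theorem colPoly_congr_zero {F : Type*} [Field F] {m n : ℕ} {s : Matrix (Fin m) (Fin n) F}
    {j : Fin n} (h : ∀ i, s i j = 0) : colPoly s j = 0 := by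
  simp [colPoly, h]

theorem sub_mem_code {p τ k r : ℕ} {F : Type*} [Field F] {g : F[X]}
    {s t : Matrix (Fin (p * τ)) (Fin (k + r)) F} (hs : s ∈ code p τ k r F g)
    (ht : t ∈ code p τ k r F g) : s - t ∈ code p τ k r F g := by
  refine ⟨fun j => ?_, ?_⟩
  · rw [colPoly_sub]
    exact Ideal.sub_mem _ (hs.1 j) (ht.1 j)
  · have h1 := hs.2
    have h2 := ht.2
    simp only [colPoly_sub]
    change (fun j : Fin r => colPoly s (Fin.natAdd k j)) -
      (fun j : Fin r => colPoly t (Fin.natAdd k j)) = _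
    rw [h1, h2, ← Matrix.sub_vecMul]
    rfl

/-- Cramer's rule via the adjugate, as the ring has zero divisors. -/
theorem monomialDet_mul_eq_zero {F : Type*} [Field F] {m k r : ℕ} (w : Fin k → PolyRing F m)
    {A : Finset (Fin k)} {J : Finset (Fin r)} {s : ℕ} (hA : A.card = s) (hJ : J.card = s)
    (hwA : ∀ i ∉ A, w i = 0) (hwJ : ∀ j ∈ J, Matrix.vecMul w (encMatrix F m k r) j = 0)
    (a : Fin s) :
    AdjoinRoot.mk (1 + X ^ m) (monomialDet F (fun a => (A.orderEmbOfFin hA a : ℕ))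
      fun b => (J.orderEmbOfFin hJ b : ℕ)) * w (A.orderEmbOfFin hA a) = 0 := by
  let M : Matrix (Fin s) (Fin s) (PolyRing F m) :=
    Matrix.of fun a b => x F m ^ ((A.orderEmbOfFin hA a : ℕ) * (J.orderEmbOfFin hJ b : ℕ))
  have hdet : AdjoinRoot.mk (1 + X ^ m) (monomialDet F (fun a => (A.orderEmbOfFin hA a : ℕ))
      fun b => (J.orderEmbOfFin hJ b : ℕ)) = M.det := by
    rw [monomialDet, RingHom.map_det]
    congr 1
  have hmul : Matrix.vecMul (w ∘ A.orderEmbOfFin hA) M = 0 := by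
    ext1 b
    have h := hwJ _ (J.orderEmbOfFin_mem hJ b)
    rw [Matrix.vecMul, dotProduct, ← Finset.sum_subset (Finset.subset_univ A)
      (fun i _ hi => by rw [hwA i hi, zero_mul])] at h
    rw [Matrix.vecMul, dotProduct, Pi.zero_apply, ← h]
    conv_rhs => rw [← Finset.map_orderEmbOfFin_univ A hA]
    rw [Finset.sum_map]
    rfl
  have hadj := congrArg (Matrix.vecMul · M.adjugate) hmul
  simp only [Matrix.vecMul_vecMul, Matrix.mul_adjugate, Matrix.vecMul_smul, Matrix.vecMul_one,
    Matrix.zero_vecMul] at hadj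
  rw [hdet]
  exact congrFun hadj a

theorem isMDS_code {p τ k r : ℕ} (hp : p.Prime) (h2 : orderOf (2 : ZMod p) = p - 1)
    (hτ : ∃ a : ℕ, τ = 2 ^ a)
    (hminor : ∀ (s : ℕ) (f g : Fin s → ℕ), StrictMono f → StrictMono g → (∀ a, f a < k) →
      (∀ a, g a < r) → ¬ cyclotomic p (ZMod 2) ∣ monomialDet (ZMod 2) f g) :
    IsMDS k r (code p τ k r (ZMod 2) 1) := by
  intro E hE s hs t ht hst
  obtain ⟨hd1, hd2⟩ := sub_mem_code hs ht
  have hd0 : ∀ j ∉ E, colPoly (s - t) j = 0 := fun j hj =>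
    colPoly_congr_zero fun i => by rw [Matrix.sub_apply, hst j hj i, sub_self]
  set d := s - t
  let A : Finset (Fin k) := Finset.univ.filter fun i => Fin.castAdd r i ∈ E
  let B : Finset (Fin r) := Finset.univ.filter fun j => Fin.natAdd k j ∈ E
  have hcard : A.card + B.card ≤ r := by
    refine le_trans ?_ hE
    rw [← Finset.card_map (s := A) (Fin.castAddEmb r),
      ← Finset.card_map (s := B) (Fin.natAddEmb k), ← Finset.card_union_of_disjoint]
    · refine Finset.card_le_card fun j hj => ?_
      simp only [Finset.mem_union, Finset.mem_map, A, B, Finset.mem_filter] at hj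
      rcases hj with ⟨i, ⟨-, hi⟩, rfl⟩ | ⟨i, ⟨-, hi⟩, rfl⟩ <;> exact hi
    · rw [Finset.disjoint_left]
      simp only [Finset.mem_map]
      rintro _ ⟨i, -, rfl⟩ ⟨j, -, hj⟩
      have := congrArg Fin.val hj
      simp at this
      omega
  -- At least `r - B.card ≥ A.card` parity columns survive.
  obtain ⟨J, hJB, hJ⟩ := Finset.exists_subset_card_eq (s := Bᶜ) (n := A.card) (by
    rw [Finset.card_compl, Fintype.card_fin]; omega)
  have hwA : ∀ i ∉ A, colPoly d (Fin.castAdd r i) = 0 := fun i hi => hd0 _ (by simpa [A] using hi)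
  have hwJ : ∀ j ∈ J, Matrix.vecMul (fun i => colPoly d (Fin.castAdd r i))
      (encMatrix (ZMod 2) (p * τ) k r) j = 0 := fun j hj => by
    rw [← hd2]
    exact hd0 _ (by simpa [B] using hJB hj)
  have hdata : ∀ i, colPoly d (Fin.castAdd r i) = 0 := fun i => by
    by_cases hi : i ∈ A
    · obtain ⟨a, rfl⟩ : ∃ a, A.orderEmbOfFin rfl a = i := by
        rw [← Finset.mem_coe, ← Finset.range_orderEmbOfFin A rfl] at hi
        exact hi
      refine eq_zero_of_mem_cyclicCode hp h2 hτ (hminor _ _ _ ?_ ?_ ?_ ?_) (hd1 _)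
        (monomialDet_mul_eq_zero _ rfl hJ hwA hwJ a)
      · exact (A.orderEmbOfFin rfl).strictMono
      · exact (J.orderEmbOfFin hJ).strictMono
      · exact fun a => Fin.is_lt _
      · exact fun a => Fin.is_lt _
    · exact hwA i hi
  have hcol : ∀ j, colPoly d j = 0 := fun j => by
    refine Fin.addCases hdata (fun j => ?_) j
    have := congrFun hd2 j
    simp only [hdata] at this
    rw [this]
    exact congrFun (Matrix.zero_vecMul _) j
  ext i j
  exact sub_eq_zero.1 (eq_zero_of_colPoly_eq_zero (hcol j) i)

end GEIP

theorem mainTheorem10 (p τ k r : ℕ) (hp : p.Prime)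
    (h2 : orderOf (2 : ZMod p) = p - 1)
    (hτ : ∃ a : ℕ, τ = 2 ^ a)
    (hk : 1 ≤ k) (hr : 9 ≤ r)
    (hkr : k = 2 ∨ k = 3 → r ≤ p)
    (hbound : (p : ℝ) - 1 >
      1 / 4 * (k : ℝ) * (r : ℝ) * min (k : ℝ) (r : ℝ) - 1 / 12 * (min (k : ℝ) (r : ℝ)) ^ 3
        - 9 / 4 * max (k : ℝ) (r : ℝ) + 25 / 12 * min (k : ℝ) (r : ℝ) - 4) :
    GEIP.IsMDS k r (GEIP.code p τ k r (ZMod 2) 1) := by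
  refine GEIP.isMDS_code hp h2 hτ fun s f g hf hg hfk hgr => ?_
  rcases le_total k r with h | h
  · have h' : (k : ℝ) ≤ r := by exact_mod_cast h
    rw [min_eq_left h', max_eq_right h'] at hbound
    exact GEIP.not_cyclotomic_dvd_monomialDet hp h2 hf hg hfk hgr h hr hkr hbound
  · have h' : (r : ℝ) ≤ k := by exact_mod_cast h
    rw [min_eq_right h', max_eq_left h'] at hbound
    -- The smaller parameter is now `r ≥ 9`, so the side condition on 2 and 3 is vacuous.
    rw [GEIP.monomialDet_comm]
    refine GEIP.not_cyclotomic_dvd_monomialDet hp h2 hg hf hgr hfk h (hr.trans h)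
      (by omega) ?_
    unfold GEIP.degreeBound
    linarith
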